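/- Consider a network with one transmitter, one receiver and $R$ parallel amplify-and-forward relays. Fix standard deviations $\sigma_{f_r},\sigma_{g_r}>0$ and power scalers $p_0,p_r>0$ ($r=1,\dots,R$). The channel coefficients $f_r\sim\mathcal{CN}(0,\sigma_{f_r}^2)$, $g_r\sim\mathcal{CN}(0,\sigma_{g_r}^2)$ are independent, and $\mathbf h=(f_1,g_1,\dots,f_R,g_R)$. For a power level $P>0$ let $P_i=p_iP$, $\rho_r=P_r/(1+|f_r|^2P_0)$, and for $\mathbf x\in\mathbb C^R$ $$\mathtt{SNR}_P(\mathbf x,\mathbf h)=\frac{P_0\bigl|\sum_{r=1}^R x_rf_rg_r\sqrt{\rho_r}\bigr|^2}{1+\sum_{r=1}^R|x_r|^2|g_r|^2\rho_r}.$$ A codebook is a compact set $\mathcal C\subset\{\mathbf x\in\mathbb C^R:|x_r|\le 1\ \forall r\}$. Its symbol error rate at $P$, for binary signalling and with the codeword of largest SNR selected for every channel state, is $\mathtt{SER}_P(\mathcal C)=\mathrm E_{\mathbf h}\bigl[\mathrm Q\bigl(\sqrt{2\max_{\mathbf x\in\mathcal C}\mathtt{SNR}_P(\mathbf x,\mathbf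 h)}\bigr)\bigr]$, where $\mathrm Q$ is the Gaussian tail function. A power-dependent codebook $\mathcal D$ assigns to every $P>0$ a codebook $\mathcal D_P$ of a common cardinality $|\mathcal D|$; it is optimal if, for every $P>0$, $\mathcal D_P$ minimizes $\mathtt{SER}_P$ among all codebooks of cardinality $|\mathcal D|$. An OMRS codebook is a codebook $\mathcal O$ all of whose vectors satisfy $\|\mathbf x\|_\infty=1$ and which either has one element or satisfies $\sum_{r=1}^R|x_r||y_r|=0$ for all distinct $\mathbf x,\mathbf y\in\mathcal O$; $\mathscr O(c)$ is the collection of OMRS codebooks of cardinality $c$. With $d_P(\mathbf x)=\min_{\mathbf y\in\mathcal D_P}\|\mathbf x-\mathbf y\|$ (Euclidean norm), let $\limsup\mathcal D=\{\mathbf x:\liminf_{P\to\infty}d_P(\mathbf x)=0\}$ and $\liminf\mathcal D=\{\mathbf x:\lim_{P\to\infty}d_P(\mathbf x)=0\}$; if the two sets agree, $\lim\mathcal D$ exists and is that set. Theorem. The following hold for any optimal power-dependent codebook $\mathcal D$ with $1\le|\mathcal D|\le R$. 1. There are constants $0<C,P^\ast<\infty$, independent of $P$ and $\mathcal D$, such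 that for all $P>P^\ast$ $$\max_{\substack{\mathbf x,\mathbf y\in\mathcal D_P\\ \mathbf x\ne\mathbf y}}\ \sum_{r=1}^R|x_r||y_r|\le\frac{C}{\log P}$$ (there being nothing to satisfy if $|\mathcal D|=1$). 2. If $\lim\mathcal D$ exists, there is $\mathcal O\in\mathscr O(|\mathcal D|)$ with $\mathcal O=\lim\mathcal D$. 3. If $\lim\mathcal D$ does not exist, there is $\mathcal O\in\mathscr O(|\mathcal D|)$ with $\mathcal O\subset\limsup\mathcal D$. -/

import Mathlib

open MeasureTheory ProbabilityTheory Filter Topology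
open scoped ENNReal NNReal

noncomputable section

/-- A beamforming vector for `R` relays, with the Euclidean norm. -/
abbrev BeamVec (R : ℕ) : Type := EuclideanSpace ℂ (Fin R)

/-- A channel state: the pair `(f r, g r)` of channel coefficients for every relay `r`. -/
abbrev Channel (R : ℕ) : Type := Fin R → ℂ × ℂ

/-- The law `CN(0, σ²)`: independent real and imaginary parts, each of law `N(0, σ² / 2)`. -/
def complexNormal (σ : ℝ) : Measure ℂ :=
  ((gaussianReal 0 (σ ^ 2 / 2).toNNReal).prod (gaussianReal 0 (σ ^ 2 / 2).toNNReal)).map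
    (fun z : ℝ × ℝ => (⟨z.1, z.2⟩ : ℂ))

/-- The Gaussian tail function. -/
def gaussianQ (x : ℝ) : ℝ := (gaussianReal 0 1).real (Set.Ioi x)

/-- The fixed parameters of a network with `R` parallel relays: the channel standard deviations
and the power constraint scalers of the transmitter (`p₀`) and of the relays (`p r`). -/
structure RelayNetwork (R : ℕ) where
  σf : Fin R → ℝ
  σg : Fin R → ℝ
  p₀ : ℝ
  p : Fin R → ℝ
  σf_pos : ∀ r, 0 < σf r
  σg_pos : ∀ r, 0 < σg r
  p₀_pos : 0 < p₀
  p_pos : ∀ r, 0 < p r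

namespace RelayNetwork

variable {R : ℕ} (N : RelayNetwork R)

/-- The law of the channel state: all the coefficients are independent,
`f r ∼ CN(0, (σf r)²)` and `g r ∼ CN(0, (σg r)²)`. -/
def channelLaw : Measure (Channel R) :=
  Measure.pi fun r => (complexNormal (N.σf r)).prod (complexNormal (N.σg r))

/-- The relay normalization factor `ρ_r = P_r / (1 + |f_r|² P_0)`, with `P_r = p_r P`. -/
def rho (P : ℝ) (h : Channel R) (r : Fin R) : ℝ :=
  N.p r * P / (1 + ‖(h r).1‖ ^ 2 * (N.p₀ * P))

/-- The received signal-to-noise ratio. -/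
def snr (P : ℝ) (x : BeamVec R) (h : Channel R) : ℝ :=
  N.p₀ * P * ‖∑ r, x r * (h r).1 * (h r).2 * (Real.sqrt (N.rho P h r) : ℂ)‖ ^ 2 /
    (1 + ∑ r, ‖x r‖ ^ 2 * ‖(h r).2‖ ^ 2 * N.rho P h r)

/-- The symbol error rate of a quantizer `q` (binary constellation) at power level `P`. -/
def ser (P : ℝ) (q : Channel R → BeamVec R) : ℝ :=
  ∫ h, gaussianQ (Real.sqrt (2 * N.snr P (q h) h)) ∂N.channelLaw

open Classical in
/-- The optimal quantizer of the codebook `C`: it picks a vector of `C` of maximal SNR (which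
exists when `C` is non-empty and compact; the SNR of the choice does not depend on the choice). -/
def optQuantizer (P : ℝ) (C : Set (BeamVec R)) (h : Channel R) : BeamVec R :=
  if H : ∃ x ∈ C, ∀ y ∈ C, N.snr P y h ≤ N.snr P x h then H.choose else 0

/-- The symbol error rate of a codebook, used with its optimal quantizer. -/
def codebookSER (P : ℝ) (C : Set (BeamVec R)) : ℝ := N.ser P (N.optQuantizer P C)

end RelayNetwork

/-- A codebook: a compact set of beamforming vectors that meet the relay power constraints. -/
def IsCodebook {R : ℕ} (C : Set (BeamVec R)) : Prop :=
  IsCompact C ∧ ∀ x ∈ C, ∀ r, ‖x r‖ ≤ 1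

/-- `D`, a codebook `D P` for every power level `P > 0`, is an optimal power-dependent codebook of
cardinality `c`: at every power level, `D P` has the least symbol error rate among all the codebooks
of cardinality `c`. -/
def RelayNetwork.IsOptimalDCodebook {R : ℕ} (N : RelayNetwork R) (c : ℕ)
    (D : ℝ → Set (BeamVec R)) : Prop :=
  ∀ P : ℝ, 0 < P → IsCodebook (D P) ∧ (D P).encard = c ∧
    ∀ C : Set (BeamVec R), IsCodebook C → C.encard = c → N.codebookSER P (D P) ≤ N.codebookSER P C

/-- The vectors of infinity-norm `1`. -/
def unitInftySphere (R : ℕ) : Set (BeamVec R) := {x | ‖(WithLp.ofLp x : Fin R → ℂ)‖ = 1}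

/-- An orthogonal multiple-relay selection (OMRS) codebook. -/
def IsOMRS {R : ℕ} (C : Set (BeamVec R)) : Prop :=
  IsCodebook C ∧ C ⊆ unitInftySphere R ∧
    (C.encard = 1 ∨ ∀ x ∈ C, ∀ y ∈ C, y ≠ x → ∑ r, ‖x r‖ * ‖y r‖ = 0)

/-- The collection of the OMRS codebooks of cardinality `c`. -/
def omrsCodebooks (R c : ℕ) : Set (Set (BeamVec R)) := {C | IsOMRS C ∧ C.encard = c}

/-- The upper limit of `D P` as `P → ∞`: the points at which the lower limit of the distance to
`D P` is `0`. -/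
def upperLimit {R : ℕ} (D : ℝ → Set (BeamVec R)) : Set (BeamVec R) :=
  {x | liminf (fun P => Metric.infEDist x (D P)) atTop = 0}

/-- The lower limit of `D P` as `P → ∞`: the points at which the distance to `D P` tends to `0`. -/
def lowerLimit {R : ℕ} (D : ℝ → Set (BeamVec R)) : Set (BeamVec R) :=
  {x | Tendsto (fun P => Metric.infEDist x (D P)) atTop (𝓝 0)}

/-- `D P` converges to `L` as `P → ∞`. -/
def ConvergesTo {R : ℕ} (D : ℝ → Set (BeamVec R)) (L : Set (BeamVec R)) : Prop :=
  lowerLimit D = L ∧ upperLimit D = L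

end

/-! ### The Gaussian tail function -/

/-! The proof counts diversity orders. Selecting one of `c` relays fails only if all `c` fail, so
its symbol error rate is `O(P⁻ᶜ)` (`exists_codebookSER_selectionCodebook_le`). Conversely, suppose
that every vector of a codebook has, on some relay of a set `S`, a component at least `ε` times each
of its components. When the relays of `S` receive almost nothing but still forward noise, and the
others forward at most `ε`, all SNRs are bounded (`exists_snr_le`). This event has probability at
least a constant times `ε^(2R) P^(-|S|)`, which bounds the error rate from below
(`exists_le_codebookSER`). For an optimal codebook with `|S| < c`, the two bounds force `ε^(2R) P`
to be bounded (`exists_mul_le_of_isOptimalDCodebook`).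

If two codewords overlap on a relay by more than `1 / log P`, that relay serves for both and the
largest component of each other codeword serves for the rest: `c - 1` relays suffice with `ε = 1 /
log P`, impossible because `P / (log P)^(2R) → ∞`. Similarly, with `ε = 1`, each codeword must be
strictly best for some channel state at high power. Were its infinity norm below `1`, scaling it up
would strictly reduce the error rate. So the codebooks eventually lie on the compact unit sphere of
the infinity norm, and a convergent subsequence of them yields the OMRS codebook
(`exists_omrs_subset_upperLimit`). -/

theorem gaussianReal_isOpenPosMeasure (μ : ℝ) {v : ℝ≥0} (hv : v ≠ 0) :
    (gaussianReal μ v).IsOpenPosMeasure :=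
  (gaussianReal_absolutelyContinuous' μ hv).isOpenPosMeasure

theorem gaussianQ_strictAnti : StrictAnti gaussianQ := by
  intro x y hxy
  have := gaussianReal_isOpenPosMeasure 0 (one_ne_zero : (1 : ℝ≥0) ≠ 0)
  have hpos : 0 < (gaussianReal 0 1).real (Set.Ioo x y) := by
    rw [measureReal_def]
    exact ENNReal.toReal_pos ((isOpen_Ioo.measure_pos _ (Set.nonempty_Ioo.2 hxy)).ne')
      (measure_ne_top _ _)
  have hdisj : Disjoint (Set.Ioo x y) (Set.Ioi y) := by
    rw [Set.disjoint_left]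
    rintro z ⟨_, h⟩ h'
    exact lt_asymm h h'
  have hle : (gaussianReal 0 1).real (Set.Ioo x y ∪ Set.Ioi y) ≤ gaussianQ x := by
    refine measureReal_mono ?_
    rintro z (h | h)
    · exact h.1
    · exact hxy.trans h
  rw [measureReal_union hdisj measurableSet_Ioi] at hle
  change (gaussianReal 0 1).real (Set.Ioi y) < _
  linarith

theorem gaussianQ_nonneg (x : ℝ) : 0 ≤ gaussianQ x := measureReal_nonneg

theorem gaussianQ_pos (x : ℝ) : 0 < gaussianQ x :=
  (gaussianQ_nonneg (x + 1)).trans_lt (gaussianQ_strictAnti (by linarith))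

theorem gaussianQ_le_one (x : ℝ) : gaussianQ x ≤ 1 := measureReal_le_one

/-- Chernoff bound, with the optimal exponential parameter `x`. -/
theorem gaussianQ_le_exp {x : ℝ} (hx : 0 ≤ x) : gaussianQ x ≤ Real.exp (-x ^ 2 / 2) := by
  have hint : Integrable (fun z : ℝ => Real.exp (x * z)) (gaussianReal 0 1) :=
    integrable_exp_mul_gaussianReal x
  have h := measure_ge_le_exp_mul_mgf (μ := gaussianReal 0 1) (X := fun z : ℝ => z) x hx hint
  rw [mgf_gaussianReal (μ := 0) (v := 1) (by simp), ← Real.exp_add] at h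
  refine (measureReal_mono (fun z hz => ?_)).trans (h.trans (le_of_eq ?_))
  · exact (Set.mem_Ioi.1 hz).le
  · congr 1
    push_cast
    ring

theorem gaussianQ_sqrt_two_mul_le_exp {s : ℝ} (hs : 0 ≤ s) :
    gaussianQ (Real.sqrt (2 * s)) ≤ Real.exp (-s) := by
  refine (gaussianQ_le_exp (Real.sqrt_nonneg _)).trans (le_of_eq ?_)
  rw [Real.sq_sqrt (by positivity)]
  congr 1
  ring

/-! ### The complex normal law -/

theorem half_sq_toNNReal_ne_zero {σ : ℝ} (hσ : 0 < σ) : (σ ^ 2 / 2).toNNReal ≠ 0 := by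
  have : 0 < σ ^ 2 / 2 := by positivity
  exact (Real.toNNReal_pos.2 this).ne'

theorem continuous_complex_mk : Continuous (fun z : ℝ × ℝ => (⟨z.1, z.2⟩ : ℂ)) :=
  Complex.equivRealProdCLM.symm.continuous

instance complexNormal_isProbabilityMeasure (σ : ℝ) : IsProbabilityMeasure (complexNormal σ) :=
  Measure.isProbabilityMeasure_map continuous_complex_mk.measurable.aemeasurable

theorem complexNormal_isOpenPosMeasure {σ : ℝ} (hσ : 0 < σ) :
    (complexNormal σ).IsOpenPosMeasure := by
  have := gaussianReal_isOpenPosMeasure 0 (half_sq_toNNReal_ne_zero hσ)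
  exact continuous_complex_mk.isOpenPosMeasure_map fun z => ⟨(z.re, z.im), rfl⟩

/-- On `[-1, 1]` the density is at least its value at `1`, which serves as `k`. -/
theorem exists_mul_le_gaussianReal_Icc {v : ℝ≥0} (hv : v ≠ 0) :
    ∃ k : ℝ, 0 < k ∧ ∀ t : ℝ, 0 ≤ t → t ≤ 1 →
      k * t ≤ (gaussianReal 0 v).real (Set.Icc (-t) t) := by
  refine ⟨gaussianPDFReal 0 v 1, gaussianPDFReal_pos _ _ _ hv, fun t ht ht1 => ?_⟩
  rw [measureReal_def, gaussianReal_apply_eq_integral _ hv, ENNReal.toReal_ofReal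
    (integral_nonneg fun x => gaussianPDFReal_nonneg _ _ _)]
  have hpdf : ∀ x ∈ Set.Icc (-t) t, gaussianPDFReal 0 v 1 ≤ gaussianPDFReal 0 v x := by
    rintro x ⟨h1, h2⟩
    rw [gaussianPDFReal_def]
    have hx : x ^ 2 ≤ 1 := by nlinarith
    simp only [sub_zero]
    refine mul_le_mul_of_nonneg_left (Real.exp_le_exp.2 ?_) (by positivity)
    exact div_le_div_of_nonneg_right (by linarith) (by positivity)
  have h := setIntegral_mono_on (μ := volume) (f := fun _ => gaussianPDFReal 0 v 1)
    (g := gaussianPDFReal 0 v) (s := Set.Icc (-t) t) (by simp)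
    (integrable_gaussianPDFReal 0 v).integrableOn measurableSet_Icc hpdf
  refine le_trans ?_ h
  rw [setIntegral_const, smul_eq_mul, measureReal_def, Real.volume_Icc,
    ENNReal.toReal_ofReal (by linarith)]
  nlinarith [gaussianPDFReal_nonneg 0 v 1]

theorem exists_mul_sq_le_complexNormal_closedBall {σ : ℝ} (hσ : 0 < σ) :
    ∃ k : ℝ, 0 < k ∧ ∀ t : ℝ, 0 ≤ t → t ≤ 1 →
      k * t ^ 2 ≤ (complexNormal σ).real {z | ‖z‖ ≤ t} := by
  obtain ⟨k, hk, h⟩ := exists_mul_le_gaussianReal_Icc (half_sq_toNNReal_ne_zero hσ)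
  refine ⟨(k / 2) ^ 2, by positivity, fun t ht ht1 => ?_⟩
  have h2 := h (t / 2) (by positivity) (by linarith)
  rw [complexNormal, map_measureReal_apply continuous_complex_mk.measurable
    (measurableSet_le measurable_norm measurable_const)]
  -- A square of half-side `t / 2` fits in the disc, since the norm is at most `|re| + |im|`.
  have hsub : Set.Icc (-(t / 2)) (t / 2) ×ˢ Set.Icc (-(t / 2)) (t / 2) ⊆
      (fun z : ℝ × ℝ => (⟨z.1, z.2⟩ : ℂ)) ⁻¹' {z | ‖z‖ ≤ t} := by
    rintro ⟨a, b⟩ ⟨⟨h1, h2⟩, h3, h4⟩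
    have := Complex.norm_le_abs_re_add_abs_im ⟨a, b⟩
    have ha : |a| ≤ t / 2 := abs_le.2 ⟨h1, h2⟩
    have hb : |b| ≤ t / 2 := abs_le.2 ⟨h3, h4⟩
    simp only [Set.mem_preimage, Set.mem_ofPred_eq]
    simp only at this
    linarith
  refine le_trans ?_ (measureReal_mono hsub)
  rw [measureReal_prod_prod]
  have h0 : 0 ≤ k * (t / 2) := by positivity
  calc (k / 2) ^ 2 * t ^ 2 = (k * (t / 2)) * (k * (t / 2)) := by ring
    _ ≤ _ := mul_le_mul h2 h2 h0 measureReal_nonneg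

theorem complexNormal_one_le_norm_pos {σ : ℝ} (hσ : 0 < σ) :
    0 < (complexNormal σ).real {z | 1 ≤ ‖z‖} := by
  have := complexNormal_isOpenPosMeasure hσ
  have hopen : IsOpen {z : ℂ | 1 < ‖z‖} := isOpen_lt continuous_const continuous_norm
  have hpos : 0 < complexNormal σ {z : ℂ | 1 ≤ ‖z‖} :=
    (hopen.measure_pos _ ⟨2, by simp⟩).trans_le (measure_mono fun z hz => by
      simp only [Set.mem_ofPred_eq] at hz ⊢
      exact hz.le)
  exact ENNReal.toReal_pos hpos.ne' (measure_ne_top _ _)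

/-- Bounding the density by its peak leaves a Gaussian integral. -/
theorem integral_exp_neg_mul_sq_gaussianReal_le {v : ℝ≥0} (hv : v ≠ 0) {b : ℝ} (hb : 0 < b) :
    ∫ x, Real.exp (-b * x ^ 2) ∂gaussianReal 0 v ≤ (Real.sqrt (2 * v * b))⁻¹ := by
  rw [integral_gaussianReal_eq_integral_smul hv]
  have hv' : 0 < (v : ℝ) := by positivity
  have hle : ∀ x, gaussianPDFReal 0 v x • Real.exp (-b * x ^ 2) ≤
      (Real.sqrt (2 * Real.pi * v))⁻¹ * Real.exp (-b * x ^ 2) := by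
    intro x
    rw [smul_eq_mul, gaussianPDFReal_def]
    have : Real.exp (-(x - 0) ^ 2 / (2 * v)) ≤ 1 := by
      rw [Real.exp_le_one_iff, neg_div, neg_nonpos]
      positivity
    gcongr
    exact mul_le_of_le_one_right (by positivity) this
  refine (integral_mono_of_nonneg (ae_of_all _ fun x => ?_)
    ((integrable_exp_neg_mul_sq hb).const_mul _) (ae_of_all _ hle)).trans (le_of_eq ?_)
  · exact mul_nonneg (gaussianPDFReal_nonneg _ _ _) (Real.exp_pos _).le
  · rw [integral_const_mul, integral_gaussian, ← Real.sqrt_inv, ← Real.sqrt_inv,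
      ← Real.sqrt_mul (by positivity)]
    congr 1
    field_simp

/-- The two real coordinates each contribute a factor of order `b^(-1/2)`. With `b` proportional to
`P`, this is one order of diversity. -/
theorem integral_exp_neg_mul_norm_sq_complexNormal_le {σ : ℝ} (hσ : 0 < σ) {b : ℝ} (hb : 0 < b) :
    ∫ z, Real.exp (-b * ‖z‖ ^ 2) ∂complexNormal σ ≤ (σ ^ 2 * b)⁻¹ := by
  rw [complexNormal, integral_map continuous_complex_mk.measurable.aemeasurable
    (by fun_prop)]
  have hv := half_sq_toNNReal_ne_zero hσ
  have hsplit : ∀ z : ℝ × ℝ, Real.exp (-b * ‖(⟨z.1, z.2⟩ : ℂ)‖ ^ 2) =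
      Real.exp (-b * z.1 ^ 2) * Real.exp (-b * z.2 ^ 2) := by
    intro z
    rw [← Real.exp_add, Complex.sq_norm, Complex.normSq_mk]
    congr 1
    ring
  simp_rw [hsplit]
  rw [integral_prod_mul (fun x : ℝ => Real.exp (-b * x ^ 2)) (fun x : ℝ => Real.exp (-b * x ^ 2))]
  have h := integral_exp_neg_mul_sq_gaussianReal_le hv hb
  have h0 : 0 ≤ ∫ x, Real.exp (-b * x ^ 2) ∂gaussianReal 0 (σ ^ 2 / 2).toNNReal :=
    integral_nonneg fun x => (Real.exp_pos _).le
  refine (mul_le_mul h h h0 (h0.trans h)).trans (le_of_eq ?_)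
  rw [← mul_inv, Real.mul_self_sqrt (by positivity), Real.coe_toNNReal _ (by positivity)]
  congr 1
  ring

/-! ### The signal-to-noise ratio -/

namespace RelayNetwork

variable {R : ℕ} (N : RelayNetwork R)

instance channelLaw_isProbabilityMeasure : IsProbabilityMeasure N.channelLaw := by
  unfold channelLaw
  infer_instance

theorem channelLaw_isOpenPosMeasure : N.channelLaw.IsOpenPosMeasure := by
  have := fun r => complexNormal_isOpenPosMeasure (N.σf_pos r)
  have := fun r => complexNormal_isOpenPosMeasure (N.σg_pos r)
  unfold channelLaw
  infer_instance

variable {P : ℝ}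

theorem one_add_normSq_mul_pos (hP : 0 < P) (h : Channel R) (r : Fin R) :
    0 < 1 + ‖(h r).1‖ ^ 2 * (N.p₀ * P) := by
  have := N.p₀_pos
  positivity

theorem rho_pos (hP : 0 < P) (h : Channel R) (r : Fin R) : 0 < N.rho P h r := by
  have := N.p_pos r
  have := N.one_add_normSq_mul_pos hP h r
  unfold rho
  positivity

theorem continuous_rho (hP : 0 < P) (r : Fin R) : Continuous fun h => N.rho P h r := by
  unfold rho
  exact Continuous.div (by fun_prop) (by fun_prop) fun h => (N.one_add_normSq_mul_pos hP h r).ne'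

theorem snr_noise_nonneg (hP : 0 < P) (x : BeamVec R) (h : Channel R) :
    0 ≤ ∑ r, ‖x r‖ ^ 2 * ‖(h r).2‖ ^ 2 * N.rho P h r :=
  Finset.sum_nonneg fun r _ => by
    have := N.rho_pos hP h r
    positivity

theorem continuous_snr (hP : 0 < P) (x : BeamVec R) : Continuous fun h => N.snr P x h := by
  have hrho := fun r => N.continuous_rho hP r
  unfold snr
  refine Continuous.div (by fun_prop) (by fun_prop) fun h => ?_
  have := N.snr_noise_nonneg hP x h
  positivity

theorem snr_nonneg (hP : 0 < P) (x : BeamVec R) (h : Channel R) : 0 ≤ N.snr P x h := by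
  have := N.snr_noise_nonneg hP x h
  have := N.p₀_pos
  unfold snr
  positivity

@[simp] theorem snr_zero (h : Channel R) : N.snr P 0 h = 0 := by simp [snr]

theorem snr_smul (t : ℝ) (x : BeamVec R) (h : Channel R) :
    N.snr P ((t : ℂ) • x) h =
      t ^ 2 * (N.p₀ * P * ‖∑ r, x r * (h r).1 * (h r).2 * (Real.sqrt (N.rho P h r) : ℂ)‖ ^ 2) /
        (1 + t ^ 2 * ∑ r, ‖x r‖ ^ 2 * ‖(h r).2‖ ^ 2 * N.rho P h r) := by
  have h1 : ∑ r, ((t : ℂ) • x) r * (h r).1 * (h r).2 * (Real.sqrt (N.rho P h r) : ℂ) =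
      t * ∑ r, x r * (h r).1 * (h r).2 * (Real.sqrt (N.rho P h r) : ℂ) := by
    rw [Finset.mul_sum]
    refine Finset.sum_congr rfl fun r _ => ?_
    simp only [PiLp.smul_apply, smul_eq_mul]
    ring
  have h2 : ∑ r, ‖((t : ℂ) • x) r‖ ^ 2 * ‖(h r).2‖ ^ 2 * N.rho P h r =
      t ^ 2 * ∑ r, ‖x r‖ ^ 2 * ‖(h r).2‖ ^ 2 * N.rho P h r := by
    rw [Finset.mul_sum]
    refine Finset.sum_congr rfl fun r _ => ?_
    simp only [PiLp.smul_apply, smul_eq_mul, norm_mul, Complex.norm_real, mul_pow,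
      Real.norm_eq_abs, sq_abs]
    ring
  rw [snr, h1, h2, norm_mul, mul_pow, Complex.norm_real, Real.norm_eq_abs, sq_abs]
  ring

/-- Along a ray the SNR is `t² A / (1 + t² B)`; the receiver noise `1` does not scale, so this
increases strictly when `A > 0`. -/
theorem snr_lt_snr_smul (hP : 0 < P) {t : ℝ} (ht : 1 < t) {x : BeamVec R} {h : Channel R}
    (hx : 0 < N.snr P x h) : N.snr P x h < N.snr P ((t : ℂ) • x) h := by
  have hB := N.snr_noise_nonneg hP x h
  rw [snr_smul]
  unfold snr at hx ⊢
  set A := N.p₀ * P * ‖∑ r, x r * (h r).1 * (h r).2 * (Real.sqrt (N.rho P h r) : ℂ)‖ ^ 2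
  set B := ∑ r, ‖x r‖ ^ 2 * ‖(h r).2‖ ^ 2 * N.rho P h r
  have hA : 0 < A := by
    by_contra hA
    exact absurd hx (not_lt.2 (div_nonpos_of_nonpos_of_nonneg (not_lt.1 hA) (by positivity)))
  rw [div_lt_div_iff₀ (by positivity) (by positivity)]
  have : 1 < t ^ 2 := by nlinarith
  nlinarith [mul_pos hA (sub_pos.2 this)]

theorem snr_le_snr_smul (hP : 0 < P) {t : ℝ} (ht : 1 < t) (x : BeamVec R) (h : Channel R) :
    N.snr P x h ≤ N.snr P ((t : ℂ) • x) h := by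
  rcases (N.snr_nonneg hP x h).eq_or_lt with h0 | h0
  · rw [← h0]
    exact N.snr_nonneg hP _ h
  · exact (N.snr_lt_snr_smul hP ht h0).le

theorem snr_single (hP : 0 < P) (r : Fin R) (h : Channel R) :
    N.snr P (EuclideanSpace.single r 1) h =
      (N.p₀ * P * ‖(h r).1‖ ^ 2) * (N.p r * P * ‖(h r).2‖ ^ 2) /
        (1 + N.p₀ * P * ‖(h r).1‖ ^ 2 + N.p r * P * ‖(h r).2‖ ^ 2) := by
  have hrho := (N.rho_pos hP h r).le
  have hd := N.one_add_normSq_mul_pos hP h r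
  have hd' : 0 < 1 + N.p₀ * P * ‖(h r).1‖ ^ 2 + N.p r * P * ‖(h r).2‖ ^ 2 := by
    have := N.p₀_pos
    have := N.p_pos r
    positivity
  have hd'' : 0 < 1 + ‖(h r).2‖ ^ 2 * N.rho P h r := by positivity
  have h1 : ∑ s, (EuclideanSpace.single r (1 : ℂ) : BeamVec R) s * (h s).1 * (h s).2 *
      (Real.sqrt (N.rho P h s) : ℂ) = (h r).1 * (h r).2 * (Real.sqrt (N.rho P h r) : ℂ) := by
    rw [Finset.sum_eq_single r]
    · simp
    · intro s _ hs
      simp [hs]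
    · simp
  have h2 : ∑ s, ‖(EuclideanSpace.single r (1 : ℂ) : BeamVec R) s‖ ^ 2 * ‖(h s).2‖ ^ 2 *
      N.rho P h s = ‖(h r).2‖ ^ 2 * N.rho P h r := by
    rw [Finset.sum_eq_single r]
    · simp
    · intro s _ hs
      simp [hs]
    · simp
  rw [snr, h1, h2, norm_mul, norm_mul, Complex.norm_real, Real.norm_eq_abs, mul_pow, mul_pow,
    sq_abs, Real.sq_sqrt hrho, div_eq_div_iff hd''.ne' hd'.ne']
  have key : N.rho P h r * (1 + ‖(h r).1‖ ^ 2 * (N.p₀ * P)) = N.p r * P :=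
    div_mul_cancel₀ _ hd.ne'
  linear_combination (N.p₀ * P * ‖(h r).1‖ ^ 2 * ‖(h r).2‖ ^ 2) * key

/-- The SNR is `A B / (1 + A + B)`. If `min A B ≥ 1`, the denominator is at most `3 max A B`;
otherwise the left side is negative. -/
theorem min_sub_one_div_three_le_snr_single (hP : 0 < P) (r : Fin R) (h : Channel R) :
    (min (N.p₀ * P * ‖(h r).1‖ ^ 2) (N.p r * P * ‖(h r).2‖ ^ 2) - 1) / 3 ≤
      N.snr P (EuclideanSpace.single r 1) h := by
  rw [N.snr_single hP]
  have hA : 0 ≤ N.p₀ * P * ‖(h r).1‖ ^ 2 := by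
    have := N.p₀_pos
    positivity
  have hB : 0 ≤ N.p r * P * ‖(h r).2‖ ^ 2 := by
    have := N.p_pos r
    positivity
  generalize N.p₀ * P * ‖(h r).1‖ ^ 2 = A at *
  generalize N.p r * P * ‖(h r).2‖ ^ 2 = B at *
  rw [div_le_div_iff₀ (by norm_num) (by positivity)]
  rcases le_total A B with hAB | hAB
  · rw [min_eq_left hAB]
    nlinarith [mul_nonneg hA hB, mul_nonneg hA (sub_nonneg.2 hAB), mul_nonneg hA hA]
  · rw [min_eq_right hAB]
    nlinarith [mul_nonneg hA hB, mul_nonneg hB (sub_nonneg.2 hAB), mul_nonneg hB hB]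

/-- If the relays of `S` receive little and forward much, and all the other relays forward little,
then every beamforming vector that is not small on `S` has a bounded SNR. -/
theorem exists_snr_le : ∃ K : ℝ, 0 ≤ K ∧ ∀ (P ε : ℝ) (x : BeamVec R) (S : Set (Fin R))
    (h : Channel R), 0 < P → (∃ s ∈ S, ∀ r, ε * ‖x r‖ ≤ ‖x s‖) →
    (∀ r ∈ S, ‖(h r).1‖ ^ 2 * P ≤ 1 ∧ 1 ≤ ‖(h r).2‖) → (∀ r ∉ S, ‖(h r).2‖ ≤ ε) →
    N.snr P x h ≤ K := by
  have hp₀ := N.p₀_pos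
  have hp := N.p_pos
  refine ⟨R * ∑ r, (N.p₀ + ∑ s, N.p r * (1 + N.p₀) / N.p s),
    mul_nonneg (by positivity) (Finset.sum_nonneg fun r _ =>
      add_nonneg hp₀.le (Finset.sum_nonneg fun s _ => ?_)), ?_⟩
  · have := hp r
    have := hp s
    positivity
  rintro P ε x S h hP ⟨s, hsS, hs⟩ hS hSc
  have hrho := fun r => N.rho_pos hP h r
  have hB := N.snr_noise_nonneg hP x h
  unfold snr
  set B := ∑ r, ‖x r‖ ^ 2 * ‖(h r).2‖ ^ 2 * N.rho P h r with hBdef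
  have hterm : ∀ r, ‖x r‖ ^ 2 * ‖(h r).2‖ ^ 2 * N.rho P h r ≤ B := fun r =>
    Finset.single_le_sum (f := fun r => ‖x r‖ ^ 2 * ‖(h r).2‖ ^ 2 * N.rho P h r)
      (fun r _ => by
        have := hrho r
        positivity) (Finset.mem_univ r)
  rw [div_le_iff₀ (by positivity)]
  -- Cauchy–Schwarz decouples the relays, so each can be compared with the noise separately.
  have hsum : ‖∑ r, x r * (h r).1 * (h r).2 * (Real.sqrt (N.rho P h r) : ℂ)‖ ^ 2 ≤
      R * ∑ r, ‖x r‖ ^ 2 * ‖(h r).1‖ ^ 2 * ‖(h r).2‖ ^ 2 * N.rho P h r := by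
    have h1 := norm_sum_le Finset.univ
      (fun r => x r * (h r).1 * (h r).2 * (Real.sqrt (N.rho P h r) : ℂ))
    have h2 := sq_sum_le_card_mul_sum_sq (s := Finset.univ)
      (f := fun r => ‖x r * (h r).1 * (h r).2 * (Real.sqrt (N.rho P h r) : ℂ)‖)
    refine (pow_le_pow_left₀ (norm_nonneg _) h1 2).trans (h2.trans (le_of_eq ?_))
    rw [Finset.card_univ, Fintype.card_fin]
    congr 1
    refine Finset.sum_congr rfl fun r _ => ?_
    rw [norm_mul, norm_mul, norm_mul, Complex.norm_real, Real.norm_eq_abs, mul_pow, mul_pow,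
      mul_pow, sq_abs, Real.sq_sqrt (hrho r).le]
  have hr : ∀ r, N.p₀ * P * (‖x r‖ ^ 2 * ‖(h r).1‖ ^ 2 * ‖(h r).2‖ ^ 2 * N.rho P h r) ≤
      (N.p₀ + ∑ s, N.p r * (1 + N.p₀) / N.p s) * (1 + B) := by
    intro r
    have hq : ∀ s, 0 ≤ N.p r * (1 + N.p₀) / N.p s := fun s => by
      have := hp r
      have := hp s
      positivity
    have hrhor := hrho r
    -- For a relay of `S` the received power is at most `p₀`, so its signal is controlled by its own
    -- noise term. For the others, the signal is controlled by the noise that relay `s` forwards: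
    -- `s` receives little, so `ρ_s` is of order `P`.
    by_cases hrS : r ∈ S
    · have h1 := (hS r hrS).1
      calc N.p₀ * P * (‖x r‖ ^ 2 * ‖(h r).1‖ ^ 2 * ‖(h r).2‖ ^ 2 * N.rho P h r)
          = N.p₀ * (‖(h r).1‖ ^ 2 * P) * (‖x r‖ ^ 2 * ‖(h r).2‖ ^ 2 * N.rho P h r) := by ring
        _ ≤ N.p₀ * 1 * (1 + B) := by
          gcongr
          linarith [hterm r]
        _ ≤ _ := by
          rw [mul_one]
          gcongr
          exact le_add_of_nonneg_right (Finset.sum_nonneg fun s _ => hq s)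
    · have hgr := hSc r hrS
      have hps := hp s
      have hpr := hp r
      have hfr : N.p₀ * P * ‖(h r).1‖ ^ 2 * N.rho P h r ≤ N.p r * P := by
        have hd := N.one_add_normSq_mul_pos hP h r
        rw [rho, mul_div_assoc', div_le_iff₀ hd]
        nlinarith [mul_pos hpr hP]
      have hxs : ‖x r‖ ^ 2 * ‖(h r).2‖ ^ 2 ≤ ‖x s‖ ^ 2 := by
        rw [← mul_pow]
        refine pow_le_pow_left₀ (by positivity) (le_trans ?_ (hs r)) 2
        rw [mul_comm]
        gcongr
      have hrhos : N.p s * P / (1 + N.p₀) ≤ N.rho P h s := by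
        unfold rho
        have := (hS s hsS).1
        have hd := N.one_add_normSq_mul_pos hP h s
        gcongr
        nlinarith
      have hB' : ‖x s‖ ^ 2 * (N.p s * P / (1 + N.p₀)) ≤ B := by
        refine le_trans ?_ (hterm s)
        have hg : 1 ≤ ‖(h s).2‖ ^ 2 := one_le_pow₀ (hS s hsS).2
        calc ‖x s‖ ^ 2 * (N.p s * P / (1 + N.p₀)) = ‖x s‖ ^ 2 * 1 * (N.p s * P / (1 + N.p₀)) := by
              ring
          _ ≤ _ := by gcongr
      calc N.p₀ * P * (‖x r‖ ^ 2 * ‖(h r).1‖ ^ 2 * ‖(h r).2‖ ^ 2 * N.rho P h r)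
          = (‖x r‖ ^ 2 * ‖(h r).2‖ ^ 2) * (N.p₀ * P * ‖(h r).1‖ ^ 2 * N.rho P h r) := by ring
        _ ≤ ‖x s‖ ^ 2 * (N.p r * P) := by gcongr
        _ = N.p r * (1 + N.p₀) / N.p s * (‖x s‖ ^ 2 * (N.p s * P / (1 + N.p₀))) := by
          field_simp
        _ ≤ N.p r * (1 + N.p₀) / N.p s * (1 + B) := by
          have := hq s
          gcongr
          linarith
        _ ≤ _ := by
          gcongr
          exact (Finset.single_le_sum (fun s _ => hq s) (Finset.mem_univ s)).trans
            (le_add_of_nonneg_left hp₀.le)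
  calc N.p₀ * P * ‖∑ r, x r * (h r).1 * (h r).2 * (Real.sqrt (N.rho P h r) : ℂ)‖ ^ 2
      ≤ N.p₀ * P * (R * ∑ r, ‖x r‖ ^ 2 * ‖(h r).1‖ ^ 2 * ‖(h r).2‖ ^ 2 * N.rho P h r) := by
        gcongr
    _ = R * ∑ r, N.p₀ * P * (‖x r‖ ^ 2 * ‖(h r).1‖ ^ 2 * ‖(h r).2‖ ^ 2 * N.rho P h r) := by
        rw [← Finset.mul_sum]
        ring
    _ ≤ R * ∑ r, (N.p₀ + ∑ s, N.p r * (1 + N.p₀) / N.p s) * (1 + B) := by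
        exact mul_le_mul_of_nonneg_left (Finset.sum_le_sum fun r _ => hr r) (by positivity)
    _ = _ := by
        rw [← Finset.sum_mul]
        ring

end RelayNetwork

/-! ### The symbol error rate -/

namespace RelayNetwork

variable {R : ℕ} (N : RelayNetwork R) {P : ℝ}

theorem optQuantizer_spec {C : Set (BeamVec R)} (hC : C.Finite) (hne : C.Nonempty)
    (h : Channel R) : N.optQuantizer P C h ∈ C ∧
      ∀ y ∈ C, N.snr P y h ≤ N.snr P (N.optQuantizer P C h) h := by
  have H : ∃ x ∈ C, ∀ y ∈ C, N.snr P y h ≤ N.snr P x h :=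
    Set.exists_max_image C (fun x => N.snr P x h) hC hne
  unfold optQuantizer
  rw [dif_pos H]
  exact H.choose_spec

theorem snr_optQuantizer_eq_zero_or_mem (C : Set (BeamVec R)) (h : Channel R) :
    N.optQuantizer P C h = 0 ∨ N.optQuantizer P C h ∈ C := by
  unfold optQuantizer
  split_ifs with H
  · exact Or.inr H.choose_spec.1
  · exact Or.inl rfl

/-- The quantizer is a mere choice and need not be measurable, but the SNR it attains is a finite
maximum of continuous functions. -/
theorem measurable_snr_optQuantizer (hP : 0 < P) {C : Set (BeamVec R)} (hC : C.Finite) :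
    Measurable fun h => N.snr P (N.optQuantizer P C h) h := by
  rcases C.eq_empty_or_nonempty with rfl | hne
  · simp [optQuantizer]
  have hne' : hC.toFinset.Nonempty := by simpa using hne
  have heq : (fun h => N.snr P (N.optQuantizer P C h) h) =
      hC.toFinset.sup' hne' (fun x h => N.snr P x h) := by
    ext h
    obtain ⟨hmem, hmax⟩ := N.optQuantizer_spec (P := P) hC hne h
    rw [Finset.sup'_apply]
    refine le_antisymm ?_ ?_
    · exact Finset.le_sup' (fun x => N.snr P x h) (by simpa using hmem)
    · exact Finset.sup'_le _ _ fun y hy => hmax y (by simpa using hy)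
  rw [heq]
  exact Finset.measurable_sup' hne' fun x _ => (N.continuous_snr hP x).measurable

theorem integrable_errorRate (hP : 0 < P) {C : Set (BeamVec R)} (hC : C.Finite) :
    Integrable (fun h => gaussianQ (Real.sqrt (2 * N.snr P (N.optQuantizer P C h) h)))
      N.channelLaw := by
  refine Integrable.of_bound ?_ 1 (ae_of_all _ fun h => ?_)
  · exact (gaussianQ_strictAnti.antitone.measurable.comp
      ((N.measurable_snr_optQuantizer hP hC).const_mul 2).sqrt).aestronglyMeasurable
  · rw [Real.norm_eq_abs, abs_of_nonneg (gaussianQ_nonneg _)]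
    exact gaussianQ_le_one _

theorem gaussianQ_sqrt_two_mul_le {a b : ℝ} (hab : a ≤ b) :
    gaussianQ (Real.sqrt (2 * b)) ≤ gaussianQ (Real.sqrt (2 * a)) :=
  gaussianQ_strictAnti.antitone (Real.sqrt_le_sqrt (by linarith))

theorem gaussianQ_sqrt_two_mul_lt {a b : ℝ} (ha : 0 ≤ a) (hab : a < b) :
    gaussianQ (Real.sqrt (2 * b)) < gaussianQ (Real.sqrt (2 * a)) :=
  gaussianQ_strictAnti (Real.sqrt_lt_sqrt (by positivity) (by linarith))

/-- A codebook that is nowhere worse, and somewhere strictly better, has a smaller symbol error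
rate. -/
theorem codebookSER_lt (hP : 0 < P) {C C' : Set (BeamVec R)} (hC : C.Finite) (hC' : C'.Finite)
    (hne : C.Nonempty) (hle : ∀ h, ∀ x ∈ C, ∃ x' ∈ C', N.snr P x h ≤ N.snr P x' h)
    {h₀ : Channel R} {x₀ : BeamVec R} (hx₀ : x₀ ∈ C')
    (hlt : ∀ x ∈ C, N.snr P x h₀ < N.snr P x₀ h₀) :
    N.codebookSER P C' < N.codebookSER P C := by
  have hne' : C'.Nonempty := ⟨x₀, hx₀⟩
  have hsnr : ∀ h, N.snr P (N.optQuantizer P C h) h ≤ N.snr P (N.optQuantizer P C' h) h := by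
    intro h
    obtain ⟨x', hx', hxx'⟩ := hle h _ (N.optQuantizer_spec (P := P) hC hne h).1
    exact hxx'.trans ((N.optQuantizer_spec hC' hne' h).2 x' hx')
  have hint := N.integrable_errorRate hP hC
  have hint' := N.integrable_errorRate hP hC'
  unfold codebookSER ser
  rw [← sub_pos, ← integral_sub hint hint', integral_pos_iff_support_of_nonneg
    (fun h => sub_nonneg.2 (gaussianQ_sqrt_two_mul_le (hsnr h))) (hint.sub hint')]
  -- By continuity the strict gain at `h₀` persists on an open set, which has positive probability.
  have hopen : IsOpen (⋂ x ∈ C, {h | N.snr P x h < N.snr P x₀ h}) :=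
    hC.isOpen_biInter fun x _ => isOpen_lt (N.continuous_snr hP x) (N.continuous_snr hP x₀)
  have := N.channelLaw_isOpenPosMeasure
  refine (hopen.measure_pos N.channelLaw ⟨h₀, by simpa using hlt⟩).trans_le
    (measure_mono fun h hh => ?_)
  simp only [Set.mem_iInter, Set.mem_ofPred_eq] at hh
  rw [Function.mem_support]
  refine (sub_pos.2 (gaussianQ_sqrt_two_mul_lt (N.snr_nonneg hP _ h) ?_)).ne'
  exact (hh _ (N.optQuantizer_spec hC hne h).1).trans_le
    ((N.optQuantizer_spec hC' hne' h).2 x₀ hx₀)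

/-- The probability that the relays of `S` receive little and forward much, while all the other
relays forward little. -/
theorem exists_le_channelLaw_outage : ∃ k : ℝ, 0 < k ∧ ∀ (P ε : ℝ) (S : Finset (Fin R)), 1 ≤ P →
    0 ≤ ε → ε ≤ 1 → ∃ E : Set (Channel R), MeasurableSet E ∧
      (∀ h ∈ E, (∀ r ∈ S, ‖(h r).1‖ ^ 2 * P ≤ 1 ∧ 1 ≤ ‖(h r).2‖) ∧ ∀ r ∉ S, ‖(h r).2‖ ≤ ε) ∧
      k * ε ^ (2 * R) ≤ P ^ S.card * N.channelLaw.real E := by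
  choose kf hkf hf using fun r => exists_mul_sq_le_complexNormal_closedBall (N.σf_pos r)
  choose kg hkg hg using fun r => exists_mul_sq_le_complexNormal_closedBall (N.σg_pos r)
  have hg1 := fun r => complexNormal_one_le_norm_pos (N.σg_pos r)
  set kl := fun r => (complexNormal (N.σg r)).real {z | 1 ≤ ‖z‖}
  have hκ : ∀ r, 0 < min (kf r * kl r) (kg r) := fun r => lt_min (mul_pos (hkf r) (hg1 r)) (hkg r)
  refine ⟨∏ r, min (kf r * kl r) (kg r), Finset.prod_pos fun r _ => hκ r,
    fun P ε S hP hε hε1 => ?_⟩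
  have hP0 : 0 < P := by linarith
  let F : Fin R → Set (ℂ × ℂ) := fun r =>
    if r ∈ S then {z : ℂ | ‖z‖ ^ 2 * P ≤ 1} ×ˢ {z : ℂ | 1 ≤ ‖z‖}
    else Set.univ ×ˢ {z : ℂ | ‖z‖ ≤ ε}
  refine ⟨Set.univ.pi F, MeasurableSet.univ_pi fun r => ?_, fun h hh => ⟨fun r hr => ?_,
    fun r hr => ?_⟩, ?_⟩
  · simp only [F]
    split_ifs
    · exact (measurableSet_le (by fun_prop) (by fun_prop)).prod
        (measurableSet_le (by fun_prop) (by fun_prop))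
    · exact MeasurableSet.univ.prod (measurableSet_le (by fun_prop) (by fun_prop))
  · have := hh r (Set.mem_univ r)
    simp only [F, if_pos hr] at this
    exact ⟨this.1, this.2⟩
  · have := hh r (Set.mem_univ r)
    simp only [F, if_neg hr] at this
    exact this.2
  · have hprob : N.channelLaw.real (Set.univ.pi F) =
        ∏ r, ((complexNormal (N.σf r)).prod (complexNormal (N.σg r))).real (F r) := by
      rw [channelLaw, measureReal_def, Measure.pi_pi, ENNReal.toReal_prod]
      rfl
    -- A relay of `S` fails with probability of order `1 / P`, cancelled by the factor `P`. The `ε ^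
    -- 2` is only needed off `S`; keeping it for every relay gives the uniform `ε ^ (2 * R)`.
    have hr : ∀ r, min (kf r * kl r) (kg r) * ε ^ 2 ≤ (if r ∈ S then P else 1) *
        ((complexNormal (N.σf r)).prod (complexNormal (N.σg r))).real (F r) := by
      intro r
      by_cases hrS : r ∈ S
      · simp only [F, if_pos hrS]
        rw [measureReal_prod_prod]
        have hs0 := Real.sqrt_nonneg P⁻¹
        have hs1 : Real.sqrt P⁻¹ ≤ 1 := Real.sqrt_le_one.2 (inv_le_one_of_one_le₀ hP)
        have h1 := hf r _ hs0 hs1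
        rw [Real.sq_sqrt (by positivity)] at h1
        have h2 : (complexNormal (N.σf r)).real {z | ‖z‖ ≤ Real.sqrt P⁻¹} ≤
            (complexNormal (N.σf r)).real {z | ‖z‖ ^ 2 * P ≤ 1} := by
          refine measureReal_mono fun z hz => ?_
          simp only [Set.mem_ofPred_eq] at hz ⊢
          rw [← le_div_iff₀ hP0, one_div]
          exact (Real.le_sqrt (norm_nonneg z) (by positivity)).1 hz
        have hkl : 0 ≤ kl r := (hg1 r).le
        calc min (kf r * kl r) (kg r) * ε ^ 2 ≤ kf r * kl r * 1 := by
              have : ε ^ 2 ≤ 1 := pow_le_one₀ hε hε1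
              have := hkf r
              gcongr
              exact min_le_left _ _
          _ = P * (kf r * P⁻¹ * kl r) := by
              field_simp
          _ ≤ _ := by
              gcongr
              exact h1.trans h2
      · simp only [F, if_neg hrS]
        rw [measureReal_prod_prod, probReal_univ, one_mul, one_mul]
        refine le_trans ?_ (hg r ε hε hε1)
        gcongr
        exact min_le_right _ _
    calc (∏ r, min (kf r * kl r) (kg r)) * ε ^ (2 * R)
        = ∏ r, min (kf r * kl r) (kg r) * ε ^ 2 := by
          rw [Finset.prod_mul_distrib, Finset.prod_const, Finset.card_univ, Fintype.card_fin,
            pow_mul]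
      _ ≤ ∏ r, (if r ∈ S then P else 1) *
          ((complexNormal (N.σf r)).prod (complexNormal (N.σg r))).real (F r) :=
          Finset.prod_le_prod (fun r _ => mul_nonneg (hκ r).le (by positivity)) fun r _ => hr r
      _ = _ := by
          rw [Finset.prod_mul_distrib, hprob]
          simp

/-- A lower bound on the symbol error rate of a codebook whose vectors are all disabled by the
failure of the relays of `S`. -/
theorem exists_le_codebookSER : ∃ k : ℝ, 0 < k ∧ ∀ (P ε : ℝ) (S : Finset (Fin R))
    (C : Set (BeamVec R)), 1 ≤ P → 0 ≤ ε → ε ≤ 1 → C.Finite →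
    (∀ x ∈ C, ∀ h, N.snr P x h ≤ 0 ∨
      ∃ z, N.snr P x h ≤ N.snr P z h ∧ ∃ s ∈ S, ∀ r, ε * ‖z r‖ ≤ ‖z s‖) →
    k * ε ^ (2 * R) ≤ P ^ S.card * N.codebookSER P C := by
  obtain ⟨K, hK, hsnr⟩ := N.exists_snr_le
  obtain ⟨k, hk, hE⟩ := N.exists_le_channelLaw_outage
  refine ⟨gaussianQ (Real.sqrt (2 * K)) * k, mul_pos (gaussianQ_pos _) hk,
    fun P ε S C hP hε hε1 hC hS => ?_⟩
  obtain ⟨E, hEm, hEh, hEp⟩ := hE P ε S hP hε hε1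
  have hP0 : 0 < P := by linarith
  have hint := N.integrable_errorRate hP0 hC
  have hle : ∀ h ∈ E, N.snr P (N.optQuantizer P C h) h ≤ K := by
    intro h hh
    -- The default value `0` of the quantizer has SNR `0`, so the empty codebook needs no exclusion.
    rcases N.snr_optQuantizer_eq_zero_or_mem (P := P) C h with h0 | hmem
    · rw [h0, snr_zero]
      exact hK
    · rcases hS _ hmem h with h0 | ⟨z, hz, s, hs, hsz⟩
      · exact h0.trans hK
      · exact hz.trans (hsnr P ε z S h hP0 ⟨s, hs, hsz⟩ (hEh h hh).1 (hEh h hh).2)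
  have h1 : gaussianQ (Real.sqrt (2 * K)) * N.channelLaw.real E ≤ N.codebookSER P C :=
    (setIntegral_ge_of_const_le_real hEm (measure_ne_top _ _)
      (fun h hh => gaussianQ_sqrt_two_mul_le (hle h hh)) hint.integrableOn).trans
      (setIntegral_le_integral hint (ae_of_all _ fun h => gaussianQ_nonneg _))
  calc gaussianQ (Real.sqrt (2 * K)) * k * ε ^ (2 * R)
      = gaussianQ (Real.sqrt (2 * K)) * (k * ε ^ (2 * R)) := by ring
    _ ≤ gaussianQ (Real.sqrt (2 * K)) * (P ^ S.card * N.channelLaw.real E) := by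
        have := gaussianQ_nonneg (Real.sqrt (2 * K))
        gcongr
    _ = P ^ S.card * (gaussianQ (Real.sqrt (2 * K)) * N.channelLaw.real E) := by ring
    _ ≤ _ := by gcongr

/-! ### Relay selection -/

/-- The codebook that selects a single one of the relays of `T`. -/
def selectionCodebook (T : Finset (Fin R)) : Set (BeamVec R) :=
  (fun r => EuclideanSpace.single r (1 : ℂ)) '' (T : Set (Fin R))

theorem finite_selectionCodebook (T : Finset (Fin R)) : (selectionCodebook T).Finite :=
  T.finite_toSet.image _

theorem isCodebook_selectionCodebook (T : Finset (Fin R)) : IsCodebook (selectionCodebook T) := by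
  refine ⟨(finite_selectionCodebook T).isCompact, ?_⟩
  rintro _ ⟨s, _, rfl⟩ r
  by_cases hrs : r = s <;> simp [hrs]

theorem encard_selectionCodebook (T : Finset (Fin R)) :
    (selectionCodebook T).encard = T.card := by
  unfold selectionCodebook
  rw [Function.Injective.encard_image, Set.encard_coe_eq_coe_finsetCard]
  intro r s hrs
  by_contra hne
  have := congrArg (fun x : BeamVec R => x r) hrs
  simp [hne] at this

theorem exp_neg_snr_single_le (hP : 0 < P) (hR : 0 < R) (r : Fin R) (h : Channel R) :
    Real.exp (-(N.snr P (EuclideanSpace.single r 1) h / R)) ≤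
      Real.exp 1 * (Real.exp (-(N.p₀ * P / (3 * R)) * ‖(h r).1‖ ^ 2) +
        Real.exp (-(N.p r * P / (3 * R)) * ‖(h r).2‖ ^ 2)) := by
  have hm := N.min_sub_one_div_three_le_snr_single hP r h
  have hR1 : (1 : ℝ) ≤ R := by exact_mod_cast hR
  have key : ∀ A : ℝ, (A - 1) / 3 ≤ N.snr P (EuclideanSpace.single r 1) h →
      Real.exp (-(N.snr P (EuclideanSpace.single r 1) h / R)) ≤
        Real.exp 1 * Real.exp (-(A / (3 * R))) := by
    intro A hA
    rw [← Real.exp_add, Real.exp_le_exp]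
    have h1 : (A - 1) / 3 / R ≤ N.snr P (EuclideanSpace.single r 1) h / R := by gcongr
    have h2 : (A - 1) / 3 / R = A / (3 * R) - 1 / (3 * R) := by
      field_simp
    have h3 : 1 / (3 * (R : ℝ)) ≤ 1 := by
      rw [div_le_one (by positivity)]
      linarith
    linarith
  rcases le_total (N.p₀ * P * ‖(h r).1‖ ^ 2) (N.p r * P * ‖(h r).2‖ ^ 2) with hAB | hAB
  · rw [min_eq_left hAB] at hm
    refine (key _ hm).trans ?_
    gcongr
    refine (le_of_eq ?_).trans (le_add_of_nonneg_right (Real.exp_pos _).le)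
    congr 1
    ring
  · rw [min_eq_right hAB] at hm
    refine (key _ hm).trans ?_
    gcongr
    refine (le_of_eq ?_).trans (le_add_of_nonneg_left (Real.exp_pos _).le)
    congr 1
    ring

theorem integrable_exp_neg_mul_norm_sq (σ : ℝ) {b : ℝ} (hb : 0 ≤ b) :
    Integrable (fun z => Real.exp (-b * ‖z‖ ^ 2)) (complexNormal σ) := by
  refine Integrable.of_bound (by fun_prop) 1 (ae_of_all _ fun z => ?_)
  rw [Real.norm_eq_abs, Real.abs_exp, Real.exp_le_one_iff]
  nlinarith [mul_nonneg hb (sq_nonneg ‖z‖)]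

/-- Relay selection among the relays of `T` has diversity order `|T|`. -/
theorem exists_codebookSER_selectionCodebook_le : ∃ K : ℝ, 0 < K ∧ ∀ (P : ℝ) (T : Finset (Fin R)),
    0 < P → T.Nonempty → P ^ T.card * N.codebookSER P (selectionCodebook T) ≤ K := by
  let M : Fin R → ℝ := fun r => Real.exp 1 * (3 * R) *
    ((N.σf r ^ 2 * N.p₀)⁻¹ + (N.σg r ^ 2 * N.p r)⁻¹)
  refine ⟨∏ r, max 1 (M r), Finset.prod_pos fun r _ => by positivity, fun P T hP hT => ?_⟩
  have hR : 0 < R := Fin.pos hT.choose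
  have hR0 : (0 : ℝ) < R := by exact_mod_cast hR
  have hp₀ := N.p₀_pos
  -- The value `1` off `T` makes the bound a product over all relays, whose expectation factors by
  -- independence.
  let φ : Fin R → ℂ × ℂ → ℝ := fun r z => if r ∈ T then
    Real.exp 1 * (Real.exp (-(N.p₀ * P / (3 * R)) * ‖z.1‖ ^ 2) +
        Real.exp (-(N.p r * P / (3 * R)) * ‖z.2‖ ^ 2)) else 1
  have hφ0 : ∀ r z, 0 ≤ φ r z := by
    intro r z
    simp only [φ]
    split_ifs <;> positivity
  have hfint : ∀ r, Integrable (fun z : ℂ × ℂ => Real.exp (-(N.p₀ * P / (3 * R)) * ‖z.1‖ ^ 2))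
      ((complexNormal (N.σf r)).prod (complexNormal (N.σg r))) := fun r =>
    (integrable_exp_neg_mul_norm_sq (N.σf r) (by positivity)).comp_fst _
  have hgint : ∀ r, Integrable (fun z : ℂ × ℂ => Real.exp (-(N.p r * P / (3 * R)) * ‖z.2‖ ^ 2))
      ((complexNormal (N.σf r)).prod (complexNormal (N.σg r))) := fun r => by
    have := N.p_pos r
    exact (integrable_exp_neg_mul_norm_sq (N.σg r) (by positivity)).comp_snd _
  have hφint : ∀ r, Integrable (φ r)
      ((complexNormal (N.σf r)).prod (complexNormal (N.σg r))) := by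
    intro r
    by_cases hrT : r ∈ T
    · simp only [φ, if_pos hrT]
      exact ((hfint r).add (hgint r)).const_mul _
    · simp only [φ, if_neg hrT]
      exact integrable_const _
  have hpoint : ∀ h, gaussianQ (Real.sqrt (2 * N.snr P
      (N.optQuantizer P (selectionCodebook T) h) h)) ≤ ∏ r, φ r (h r) := by
    intro h
    have hspec := N.optQuantizer_spec (P := P) (finite_selectionCodebook T)
      ((Finset.coe_nonempty.2 hT).image _) h
    refine (gaussianQ_sqrt_two_mul_le_exp (N.snr_nonneg hP _ h)).trans ?_
    -- The maximum dominates this average because `|T| ≤ R`; the exponential of a sum then splits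
    -- into one factor per relay.
    have hsum : ∑ r ∈ T, N.snr P (EuclideanSpace.single r 1) h / R ≤
        N.snr P (N.optQuantizer P (selectionCodebook T) h) h := by
      have h0 := N.snr_nonneg hP (N.optQuantizer P (selectionCodebook T) h) h
      calc ∑ r ∈ T, N.snr P (EuclideanSpace.single r 1) h / R
          ≤ ∑ r ∈ T, N.snr P (N.optQuantizer P (selectionCodebook T) h) h / R := by
            refine Finset.sum_le_sum fun r hr => ?_
            exact div_le_div_of_nonneg_right (hspec.2 _ ⟨r, hr, rfl⟩) hR0.le
        _ ≤ ∑ r : Fin R, N.snr P (N.optQuantizer P (selectionCodebook T) h) h / R :=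
            Finset.sum_le_sum_of_subset_of_nonneg (Finset.subset_univ T)
              fun r _ _ => by positivity
        _ = _ := by
            rw [Finset.sum_const, Finset.card_univ, Fintype.card_fin, nsmul_eq_mul]
            field_simp
    calc Real.exp (-N.snr P (N.optQuantizer P (selectionCodebook T) h) h)
        ≤ Real.exp (∑ r ∈ T, -(N.snr P (EuclideanSpace.single r 1) h / R)) := by
          rw [Finset.sum_neg_distrib, Real.exp_le_exp]
          linarith
      _ = ∏ r, if r ∈ T then Real.exp (-(N.snr P (EuclideanSpace.single r 1) h / R)) else 1 := by
          rw [Real.exp_sum, Finset.prod_ite_mem, Finset.univ_inter]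
      _ ≤ _ := by
          refine Finset.prod_le_prod (fun r _ => by split_ifs <;> positivity) fun r _ => ?_
          simp only [φ]
          split_ifs
          · exact N.exp_neg_snr_single_le hP hR r h
          · exact le_rfl
  have hle : N.codebookSER P (selectionCodebook T) ≤
      ∏ r, ∫ z, φ r z ∂((complexNormal (N.σf r)).prod (complexNormal (N.σg r))) := by
    rw [← integral_fintype_prod_eq_prod]
    exact integral_mono_of_nonneg (ae_of_all _ fun h => gaussianQ_nonneg _)
      (Integrable.fintype_prod_dep hφint) (ae_of_all _ hpoint)
  have hr : ∀ r, (if r ∈ T then P else 1) *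
      ∫ z, φ r z ∂((complexNormal (N.σf r)).prod (complexNormal (N.σg r))) ≤ max 1 (M r) := by
    intro r
    have hpr := N.p_pos r
    have hσf := N.σf_pos r
    have hσg := N.σg_pos r
    by_cases hrT : r ∈ T
    · simp only [φ, if_pos hrT]
      refine le_trans ?_ (le_max_right _ _)
      rw [integral_const_mul, integral_add (hfint r) (hgint r),
        integral_fun_fst (fun z => Real.exp (-(N.p₀ * P / (3 * R)) * ‖z‖ ^ 2)),
        integral_fun_snd (fun z => Real.exp (-(N.p r * P / (3 * R)) * ‖z‖ ^ 2)),
        probReal_univ, probReal_univ, one_smul, one_smul]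
      have h1 := integral_exp_neg_mul_norm_sq_complexNormal_le hσf
        (b := N.p₀ * P / (3 * R)) (by positivity)
      have h2 := integral_exp_neg_mul_norm_sq_complexNormal_le hσg
        (b := N.p r * P / (3 * R)) (by positivity)
      calc _ ≤ P * (Real.exp 1 * ((N.σf r ^ 2 * (N.p₀ * P / (3 * R)))⁻¹ +
            (N.σg r ^ 2 * (N.p r * P / (3 * R)))⁻¹)) := by gcongr
        _ = M r := by
          simp only [M]
          field_simp
    · simp [φ, if_neg hrT]
  calc P ^ T.card * N.codebookSER P (selectionCodebook T)
      ≤ P ^ T.card * ∏ r, ∫ z, φ r z ∂((complexNormal (N.σf r)).prod (complexNormal (N.σg r))) := by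
        gcongr
    _ = ∏ r, ((if r ∈ T then P else 1) *
        ∫ z, φ r z ∂((complexNormal (N.σf r)).prod (complexNormal (N.σg r)))) := by
        rw [Finset.prod_mul_distrib]
        simp
    _ ≤ _ := Finset.prod_le_prod (fun r _ => mul_nonneg (by split_ifs <;> positivity)
        (integral_nonneg (hφ0 r))) fun r _ => hr r

end RelayNetwork

/-! ### Optimal codebooks at high power -/

namespace RelayNetwork

variable {R : ℕ} (N : RelayNetwork R)

/-- At high power, fewer than `c` relays cannot disable all the vectors of an optimal codebook of
cardinality `c`. -/
theorem exists_mul_le_of_isOptimalDCodebook : ∃ k K : ℝ, 0 < k ∧ 0 < K ∧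
    ∀ (c : ℕ) (D : ℝ → Set (BeamVec R)), 1 ≤ c → c ≤ R → N.IsOptimalDCodebook c D →
      ∀ (P ε : ℝ) (S : Finset (Fin R)), 1 ≤ P → 0 ≤ ε → ε ≤ 1 → S.card + 1 ≤ c →
        (∀ x ∈ D P, ∀ h, N.snr P x h ≤ 0 ∨
          ∃ z, N.snr P x h ≤ N.snr P z h ∧ ∃ s ∈ S, ∀ r, ε * ‖z r‖ ≤ ‖z s‖) →
        k * ε ^ (2 * R) * P ≤ K := by
  obtain ⟨k, hk, hlow⟩ := N.exists_le_codebookSER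
  obtain ⟨K, hK, hupp⟩ := N.exists_codebookSER_selectionCodebook_le
  refine ⟨k, K, hk, hK, fun c D hc hcR hD P ε S hP hε hε1 hSc hS => ?_⟩
  have hP0 : 0 < P := by linarith
  obtain ⟨-, hcard, hmin⟩ := hD P hP0
  have hfin : (D P).Finite := Set.finite_of_encard_eq_coe hcard
  have h1 := hlow P ε S (D P) hP hε hε1 hfin hS
  obtain ⟨T, -, hT⟩ := Finset.exists_subset_card_eq
    (show c ≤ (Finset.univ : Finset (Fin R)).card by simpa using hcR)
  have h2 := hupp P T hP0 (Finset.card_pos.1 (by omega))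
  have h3 := hmin _ (isCodebook_selectionCodebook T) (by rw [encard_selectionCodebook, hT])
  rw [hT] at h2
  have h0 : 0 ≤ N.codebookSER P (D P) := integral_nonneg fun h => gaussianQ_nonneg _
  calc k * ε ^ (2 * R) * P ≤ P ^ S.card * N.codebookSER P (D P) * P := by gcongr
    _ = P ^ (S.card + 1) * N.codebookSER P (D P) := by ring
    _ ≤ P ^ c * N.codebookSER P (selectionCodebook T) := by
        gcongr
    _ ≤ K := h2

/-- The failure of the relay `a z` disables `z` with `ε = 1`. -/
theorem exists_norm_apply_le_of_pos (hR : 0 < R) :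
    ∃ a : BeamVec R → Fin R, ∀ (z : BeamVec R) r, ‖z r‖ ≤ ‖z (a z)‖ := by
  have : Nonempty (Fin R) := ⟨⟨0, hR⟩⟩
  choose a ha using fun z : BeamVec R => Finite.exists_max fun r => ‖z r‖
  exact ⟨a, ha⟩

/-- The vectors of optimal codebooks are almost orthogonal in absolute value at high power. -/
theorem exists_sum_norm_mul_norm_le : ∃ C P₁ : ℝ, 0 < C ∧ 0 < P₁ ∧
    ∀ (c : ℕ) (D : ℝ → Set (BeamVec R)), 1 ≤ c → c ≤ R → N.IsOptimalDCodebook c D →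
      ∀ P : ℝ, P₁ < P → ∀ x ∈ D P, ∀ y ∈ D P, x ≠ y →
        ∑ r, ‖x r‖ * ‖y r‖ ≤ C / Real.log P := by
  obtain ⟨k, K, hk, hK, hgap⟩ := N.exists_mul_le_of_isOptimalDCodebook
  -- With `k / (2 * K)`, the bound to be contradicted becomes `k * P ≤ k * P / 2`.
  have hlog := (Real.isLittleO_pow_log_id_atTop (n := 2 * R)).def
    (show 0 < k / (2 * K) by positivity)
  obtain ⟨P₁, hP₁⟩ := eventually_atTop.1 hlog
  -- `R + 1` keeps the constant positive when `R = 0`; `P > e` makes `1 / log P` an admissible `ε`.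
  refine ⟨R + 1, max P₁ (Real.exp 1), by positivity, lt_max_of_lt_right (Real.exp_pos 1),
    fun c D hc hcR hD P hP x hx y hy hxy => ?_⟩
  have hPe : Real.exp 1 < P := (le_max_right _ _).trans_lt hP
  have hP1 : 1 < P := lt_trans (by simp) hPe
  have hP0 : 0 < P := by linarith
  have hl1 : 1 < Real.log P := (Real.lt_log_iff_exp_lt hP0).2 hPe
  have hl0 : 0 < Real.log P := by linarith
  obtain ⟨⟨-, hbd⟩, hcard, -⟩ := hD P hP0
  have hfin : (D P).Finite := Set.finite_of_encard_eq_coe hcard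
  have hterm : ∀ r, ‖x r‖ * ‖y r‖ ≤ (Real.log P)⁻¹ := by
    intro r
    by_contra! hr
    have hεle : (Real.log P)⁻¹ ≤ 1 := inv_le_one_of_one_le₀ hl1.le
    have hε0 : 0 < (Real.log P)⁻¹ := by positivity
    have hxr : (Real.log P)⁻¹ ≤ ‖x r‖ :=
      hr.le.trans (mul_le_of_le_one_right (norm_nonneg _) (hbd y hy r))
    have hyr : (Real.log P)⁻¹ ≤ ‖y r‖ :=
      hr.le.trans (mul_le_of_le_one_left (norm_nonneg _) (hbd x hx r))
    classical
    obtain ⟨a, ha⟩ := exists_norm_apply_le_of_pos (Fin.pos r)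
    have hFc : hfin.toFinset.card = c := by
      rw [hfin.encard_eq_coe_toFinset_card] at hcard
      exact_mod_cast hcard
    have hxF : x ∈ hfin.toFinset := by simpa using hx
    have hyF : y ∈ hfin.toFinset.erase x := by simpa using ⟨hxy.symm, hy⟩
    -- The relay `r` serves for both `x` and `y`, which saves one relay: at most `1 + (c - 2)` are
    -- used.
    have hS : (insert r (((hfin.toFinset.erase x).erase y).image a)).card + 1 ≤ c := by
      have h1 := Finset.card_insert_le r (((hfin.toFinset.erase x).erase y).image a)
      have h2 := Finset.card_image_le (s := (hfin.toFinset.erase x).erase y) (f := a)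
      have h3 := Finset.card_erase_add_one hyF
      have h4 := Finset.card_erase_add_one hxF
      omega
    have hle := hgap c D hc hcR hD P (Real.log P)⁻¹ _ hP1.le hε0.le hεle hS fun z hz h =>
      Or.inr ⟨z, le_rfl, by
        have hdom : ∀ t, (Real.log P)⁻¹ * ‖z t‖ ≤ (Real.log P)⁻¹ :=
          fun t => mul_le_of_le_one_right hε0.le (hbd z hz t)
        by_cases hzx : z = x
        · subst hzx
          exact ⟨r, Finset.mem_insert_self _ _, fun t => (hdom t).trans hxr⟩
        by_cases hzy : z = y
        · subst hzy
          exact ⟨r, Finset.mem_insert_self _ _, fun t => (hdom t).trans hyr⟩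
        refine ⟨a z, Finset.mem_insert_of_mem (Finset.mem_image_of_mem a ?_), fun t => ?_⟩
        · simp [hzx, hzy, hz]
        · exact (mul_le_of_le_one_left (norm_nonneg _) hεle).trans (ha z t)⟩
    have hP' := hP₁ P ((le_max_left _ _).trans hP.le)
    rw [Real.norm_eq_abs, abs_of_nonneg (by positivity), id, Real.norm_eq_abs, abs_of_pos hP0]
      at hP'
    have hpow : 0 < Real.log P ^ (2 * R) := by positivity
    have h1 : k * P ≤ K * Real.log P ^ (2 * R) := by
      rw [inv_pow] at hle
      calc k * P = k * (Real.log P ^ (2 * R))⁻¹ * P * Real.log P ^ (2 * R) := by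
            field_simp
        _ ≤ _ := by gcongr
    have h2 : K * Real.log P ^ (2 * R) ≤ k * P / 2 :=
      calc K * Real.log P ^ (2 * R) ≤ K * (k / (2 * K) * P) := by gcongr
        _ = k * P / 2 := by field_simp
    have := mul_pos hk hP0
    linarith
  calc ∑ r, ‖x r‖ * ‖y r‖ ≤ ∑ _r : Fin R, (Real.log P)⁻¹ :=
        Finset.sum_le_sum fun r _ => hterm r
    _ = R / Real.log P := by
        rw [Finset.sum_const, Finset.card_univ, Fintype.card_fin, nsmul_eq_mul, div_eq_mul_inv]
    _ ≤ _ := by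
        gcongr
        linarith

/-- The vectors of optimal codebooks have infinity-norm `1` at high power. -/
theorem exists_subset_unitInftySphere : ∃ P₁ : ℝ, 0 < P₁ ∧
    ∀ (c : ℕ) (D : ℝ → Set (BeamVec R)), 1 ≤ c → c ≤ R → N.IsOptimalDCodebook c D →
      ∀ P : ℝ, P₁ < P → D P ⊆ unitInftySphere R := by
  obtain ⟨k, K, hk, hK, hgap⟩ := N.exists_mul_le_of_isOptimalDCodebook
  refine ⟨max 1 (K / k), lt_max_of_lt_left one_pos, fun c D hc hcR hD P hP x hx => ?_⟩
  have hP1 : 1 < P := (le_max_left _ _).trans_lt hP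
  have hP0 : 0 < P := by linarith
  obtain ⟨⟨-, hbd⟩, hcard, hmin⟩ := hD P hP0
  have hfin : (D P).Finite := Set.finite_of_encard_eq_coe hcard
  -- Otherwise `x` is redundant: the largest components of the other `c - 1` vectors disable the
  -- whole codebook with `ε = 1`, contradicting `P > K / k`.
  obtain ⟨h₀, hpos, hbest⟩ : ∃ h₀, 0 < N.snr P x h₀ ∧
      ∀ z ∈ D P, z ≠ x → N.snr P z h₀ < N.snr P x h₀ := by
    by_contra! hdom
    classical
    obtain ⟨a, ha⟩ := exists_norm_apply_le_of_pos (R := R) (by omega)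
    have hFc : hfin.toFinset.card = c := by
      rw [hfin.encard_eq_coe_toFinset_card] at hcard
      exact_mod_cast hcard
    have hS : ((hfin.toFinset.erase x).image a).card + 1 ≤ c := by
      have h2 := Finset.card_image_le (s := hfin.toFinset.erase x) (f := a)
      have h4 := Finset.card_erase_add_one (show x ∈ hfin.toFinset by simpa using hx)
      omega
    have hle := hgap c D hc hcR hD P 1 _ hP1.le zero_le_one le_rfl hS fun z hz h => by
      rcases le_or_gt (N.snr P z h) 0 with h0 | h0
      · exact Or.inl h0
      refine Or.inr ?_
      obtain ⟨w, hw, hwx, hzw⟩ : ∃ w ∈ D P, w ≠ x ∧ N.snr P z h ≤ N.snr P w h := by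
        by_cases hzx : z = x
        · subst hzx
          exact hdom h h0
        · exact ⟨z, hz, hzx, le_rfl⟩
      refine ⟨w, hzw, a w, Finset.mem_image_of_mem a ?_, fun r => ?_⟩
      · simp [hw, hwx]
      · rw [one_mul]
        exact ha w r
    rw [one_pow, mul_one, mul_comm, ← le_div_iff₀ hk] at hle
    exact absurd ((le_max_right _ _).trans_lt hP) (not_lt.2 hle)
  by_contra hne
  have hle1 : ‖(WithLp.ofLp x : Fin R → ℂ)‖ ≤ 1 :=
    (pi_norm_le_iff_of_nonneg zero_le_one).2 fun r => hbd x hx r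
  have hlt1 : ‖(WithLp.ofLp x : Fin R → ℂ)‖ < 1 := lt_of_le_of_ne hle1 hne
  have hx0 : 0 < ‖(WithLp.ofLp x : Fin R → ℂ)‖ := by
    rw [norm_pos_iff]
    intro h0
    have : x = 0 := by
      ext r
      exact congrFun h0 r
    rw [this, snr_zero] at hpos
    exact lt_irrefl _ hpos
  have ht : 1 < ‖(WithLp.ofLp x : Fin R → ℂ)‖⁻¹ := (one_lt_inv₀ hx0).2 hlt1
  set t := ‖(WithLp.ofLp x : Fin R → ℂ)‖⁻¹ with htdef
  have hx' := N.snr_lt_snr_smul hP0 ht hpos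
  have hbest' : ∀ z ∈ D P, N.snr P z h₀ < N.snr P ((t : ℂ) • x) h₀ := by
    intro z hz
    by_cases hzx : z = x
    · rwa [hzx]
    · exact (hbest z hz hzx).trans hx'
  -- Hence replacing `x` by its rescaling preserves the cardinality.
  have hnot : (t : ℂ) • x ∉ D P := fun hmem => lt_irrefl _ (hbest' _ hmem)
  have hcard' : (insert ((t : ℂ) • x) (D P \ {x})).encard = c := by
    rw [Set.encard_insert_of_notMem fun hmem => hnot hmem.1, Set.encard_sdiff_singleton_add_one hx,
      hcard]
  have hfin' : (insert ((t : ℂ) • x) (D P \ {x})).Finite := Set.finite_of_encard_eq_coe hcard'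
  refine absurd (hmin (insert ((t : ℂ) • x) (D P \ {x})) ⟨hfin'.isCompact, ?_⟩ hcard')
    (not_le.2 (N.codebookSER_lt hP0 hfin hfin' ⟨x, hx⟩ ?_ (Set.mem_insert _ _) hbest'))
  · rintro z (rfl | hz) r
    · rw [PiLp.smul_apply, norm_smul, Complex.norm_real, htdef, norm_inv, norm_norm,
        inv_mul_le_one₀ hx0]
      exact norm_le_pi_norm (WithLp.ofLp x) r
    · exact hbd z hz.1 r
  · intro h z hz
    by_cases hzx : z = x
    · subst hzx
      exact ⟨_, Set.mem_insert _ _, N.snr_le_snr_smul hP0 ht z h⟩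
    · exact ⟨z, Set.mem_insert_of_mem _ ⟨hz, hzx⟩, le_rfl⟩

end RelayNetwork

/-! ### Limits of codebooks -/

theorem isCompact_unitInftySphere (R : ℕ) : IsCompact (unitInftySphere R) := by
  have h : unitInftySphere R = WithLp.toLp 2 '' Metric.sphere (0 : Fin R → ℂ) 1 := by
    ext x
    constructor
    · intro hx
      exact ⟨WithLp.ofLp x, mem_sphere_zero_iff_norm.2 hx, rfl⟩
    · rintro ⟨y, hy, rfl⟩
      exact mem_sphere_zero_iff_norm.1 hy
  rw [h]
  exact (isCompact_sphere _ _).image (PiLp.continuous_toLp 2 _)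

theorem norm_apply_le_one_of_mem_unitInftySphere {R : ℕ} {x : BeamVec R}
    (hx : x ∈ unitInftySphere R) (r : Fin R) : ‖x r‖ ≤ 1 :=
  (norm_le_pi_norm (WithLp.ofLp x) r).trans (le_of_eq hx)

theorem sum_norm_mul_self_ne_zero_of_mem_unitInftySphere {R : ℕ} {x : BeamVec R}
    (hx : x ∈ unitInftySphere R) : ∑ r, ‖x r‖ * ‖x r‖ ≠ 0 := by
  intro h0
  rw [Finset.sum_eq_zero_iff_of_nonneg fun r _ => by positivity] at h0
  have hx0 : WithLp.ofLp x = 0 := by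
    ext1 r
    simpa using h0 r (Finset.mem_univ r)
  have hx1 : ‖WithLp.ofLp x‖ = 1 := hx
  rw [hx0, norm_zero] at hx1
  exact zero_ne_one hx1

theorem exists_injective_range_eq_of_encard_eq {α : Type*} {s : Set α} {c : ℕ}
    (hs : s.encard = c) : ∃ f : Fin c → α, Function.Injective f ∧ Set.range f = s := by
  have hfin : s.Finite := Set.finite_of_encard_eq_coe hs
  have hcard : hfin.toFinset.card = c := by
    rw [hfin.encard_eq_coe_toFinset_card] at hs
    exact_mod_cast hs
  let e := hfin.toFinset.equivFinOfCardEq hcard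
  refine ⟨fun i => (e.symm i : α), fun i j hij => e.symm.injective (Subtype.ext hij), ?_⟩
  ext x
  constructor
  · rintro ⟨i, rfl⟩
    exact hfin.mem_toFinset.1 (e.symm i).2
  · intro hx
    exact ⟨e ⟨x, by simpa using hx⟩, by simp⟩

/-- A family of codebooks on the unit sphere whose vectors become orthogonal in absolute value along
a sequence of power levels accumulates at an OMRS codebook. -/
theorem exists_omrs_subset_upperLimit {R c : ℕ} {D : ℝ → Set (BeamVec R)} {p b : ℕ → ℝ}
    (hp : Tendsto p atTop atTop) (hb : Tendsto b atTop (𝓝 0))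
    (hcard : ∀ n, (D (p n)).encard = c) (hD : ∀ n, D (p n) ⊆ unitInftySphere R)
    (horth : ∀ n, ∀ x ∈ D (p n), ∀ y ∈ D (p n), x ≠ y → ∑ r, ‖x r‖ * ‖y r‖ ≤ b n) :
    ∃ O ∈ omrsCodebooks R c, O ⊆ upperLimit D ∧ lowerLimit D ⊆ O := by
  choose u hinj hrange using fun n => exists_injective_range_eq_of_encard_eq (hcard n)
  have hu : ∀ n i, u n i ∈ D (p n) := fun n i => by
    rw [← hrange n]
    exact Set.mem_range_self i
  -- Compactness is applied to enumerated codebooks, so that all codewords converge along one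
  -- subsequence.
  obtain ⟨v, hv, φ, hφ, hlim⟩ :=
    (isCompact_univ_pi fun _ : Fin c => isCompact_unitInftySphere R).tendsto_subseq
      (x := u) fun n i _ => hD n (hu n i)
  have hv1 : ∀ i, v i ∈ unitInftySphere R := fun i => hv i (Set.mem_univ i)
  have hlim' : ∀ i, Tendsto (fun n => u (φ n) i) atTop (𝓝 (v i)) := tendsto_pi_nhds.1 hlim
  have hpφ : Tendsto (fun n => p (φ n)) atTop atTop := hp.comp hφ.tendsto_atTop
  have hzero : ∀ i j, i ≠ j → ∑ r, ‖v i r‖ * ‖v j r‖ = 0 := by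
    intro i j hij
    have hcont : Continuous fun z : BeamVec R × BeamVec R => ∑ r, ‖z.1 r‖ * ‖z.2 r‖ := by
      fun_prop
    have h1 := (hcont.tendsto (v i, v j)).comp ((hlim' i).prodMk_nhds (hlim' j))
    refine le_antisymm (le_of_tendsto_of_tendsto' h1 (hb.comp hφ.tendsto_atTop) fun n => ?_)
      (Finset.sum_nonneg fun r _ => by positivity)
    exact horth (φ n) _ (hu _ i) _ (hu _ j) fun h => hij (hinj _ h)
  -- Orthogonality in absolute value prevents nonzero limits from merging, so the cardinality
  -- survives.
  have hvinj : Function.Injective v := by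
    intro i j hij
    by_contra hne
    have := hzero i j hne
    rw [← hij] at this
    exact sum_norm_mul_self_ne_zero_of_mem_unitInftySphere (hv1 i) this
  have hvcard : (Set.range v).encard = c := by
    rw [← Set.image_univ, hvinj.encard_image, Set.encard_univ]
    simp
  -- The orthogonality alternative also covers a single codeword, vacuously.
  refine ⟨Set.range v, ⟨⟨⟨(Set.finite_range v).isCompact, ?_⟩, ?_, Or.inr ?_⟩, hvcard⟩, ?_, ?_⟩
  · rintro _ ⟨i, rfl⟩
    exact norm_apply_le_one_of_mem_unitInftySphere (hv1 i)
  · rintro _ ⟨i, rfl⟩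
    exact hv1 i
  · rintro _ ⟨i, rfl⟩ _ ⟨j, rfl⟩ hne
    exact hzero i j fun h => hne (by rw [h])
  · rintro _ ⟨i, rfl⟩
    have h1 : Tendsto (fun n => Metric.infEDist (v i) (D (p (φ n)))) atTop (𝓝 0) := by
      refine tendsto_of_tendsto_of_tendsto_of_le_of_le tendsto_const_nhds
        (tendsto_iff_edist_tendsto_0.1 (hlim' i)) (fun n => zero_le) fun n => ?_
      simp only
      rw [edist_comm]
      exact Metric.infEDist_le_edist_of_mem (hu _ i)
    have h2 : liminf (fun P => Metric.infEDist (v i) (D P)) atTop ≤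
        liminf (fun n => Metric.infEDist (v i) (D (p (φ n)))) atTop := hpφ.liminf_le_liminf_comp
    rw [h1.liminf_eq] at h2
    exact le_antisymm h2 zero_le
  · intro x hx
    have hlow : Tendsto (fun P => Metric.infEDist x (D P)) atTop (𝓝 0) := hx
    have hx' : Tendsto (fun n => Metric.infEDist x (D (p (φ n)))) atTop (𝓝 0) := hlow.comp hpφ
    -- The sum over all `i` avoids tracking which codeword is nearest to `x`.
    have h1 : ∀ n, Metric.infEDist x (Set.range v) ≤
        Metric.infEDist x (D (p (φ n))) + ∑ i, edist (u (φ n) i) (v i) := by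
      intro n
      rw [← hrange, ← tsub_le_iff_right]
      refine Metric.le_infEDist.2 ?_
      rintro _ ⟨i, rfl⟩
      rw [tsub_le_iff_right]
      calc Metric.infEDist x (Set.range v) ≤ edist x (v i) :=
            Metric.infEDist_le_edist_of_mem (Set.mem_range_self i)
        _ ≤ edist x (u (φ n) i) + edist (u (φ n) i) (v i) := edist_triangle _ _ _
        _ ≤ _ := by
            gcongr
            exact Finset.single_le_sum (f := fun i => edist (u (φ n) i) (v i))
              (fun _ _ => zero_le) (Finset.mem_univ i)
    have h2 : Tendsto (fun n => Metric.infEDist x (D (p (φ n))) + ∑ i, edist (u (φ n) i) (v i))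
        atTop (𝓝 0) := by
      have := hx'.add (tendsto_finsetSum Finset.univ fun i _ =>
        tendsto_iff_edist_tendsto_0.1 (hlim' i))
      simpa using this
    have h3 : Metric.infEDist x (Set.range v) = 0 :=
      le_antisymm (ge_of_tendsto' h2 h1) zero_le
    rwa [← Metric.mem_closure_iff_infEDist_zero, (Set.finite_range v).isClosed.closure_eq] at h3

theorem theorem6 {R : ℕ} (N : RelayNetwork R) :
    (∃ C P₁ : ℝ, 0 < C ∧ 0 < P₁ ∧
      ∀ (c : ℕ) (D : ℝ → Set (BeamVec R)), 1 ≤ c → c ≤ R → N.IsOptimalDCodebook c D →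
        ∀ P : ℝ, P₁ < P → ∀ x ∈ D P, ∀ y ∈ D P, x ≠ y →
          ∑ r, ‖x r‖ * ‖y r‖ ≤ C / Real.log P) ∧
    ∀ (c : ℕ) (D : ℝ → Set (BeamVec R)), 1 ≤ c → c ≤ R → N.IsOptimalDCodebook c D →
      (∀ L : Set (BeamVec R), ConvergesTo D L → ∃ O ∈ omrsCodebooks R c, O = L) ∧
      ((¬ ∃ L : Set (BeamVec R), ConvergesTo D L) →
        ∃ O ∈ omrsCodebooks R c, O ⊆ upperLimit D) := by
  refine ⟨N.exists_sum_norm_mul_norm_le, fun c D hc hcR hD => ?_⟩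
  obtain ⟨C, P₁, -, -, horth⟩ := N.exists_sum_norm_mul_norm_le
  obtain ⟨P₂, hP₂, hsphere⟩ := N.exists_subset_unitInftySphere
  let p : ℕ → ℝ := fun n => n + (max P₁ P₂ + 1)
  have hp : Tendsto p atTop atTop :=
    tendsto_atTop_add_const_right _ _ tendsto_natCast_atTop_atTop
  have hpn : ∀ n, max P₁ P₂ < p n := fun n => by
    have : (0 : ℝ) ≤ n := n.cast_nonneg
    simp only [p]
    linarith
  have hp₁ : ∀ n, P₁ < p n := fun n => (le_max_left _ _).trans_lt (hpn n)
  have hp₂ : ∀ n, P₂ < p n := fun n => (le_max_right _ _).trans_lt (hpn n)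
  obtain ⟨O, hO, hupper, hlower⟩ := exists_omrs_subset_upperLimit (D := D) hp
    ((Real.tendsto_log_atTop.comp hp).const_div_atTop C)
    (fun n => (hD _ (hP₂.trans (hp₂ n))).2.1) (fun n => hsphere c D hc hcR hD _ (hp₂ n))
    (fun n => horth c D hc hcR hD _ (hp₁ n))
  -- `O` lies between the lower and the upper limit, so it equals the limit when they agree.
  refine ⟨fun L hL => ⟨O, hO, Set.Subset.antisymm ?_ ?_⟩, fun _ => ⟨O, hO, hupper⟩⟩
  · exact hupper.trans hL.2.subset
  · exact hL.1.symm.subset.trans hlower
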